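/- Let $(\Omega,\Sigma,\mu)$ be a probability space and let $(f_n)_{n\ge 1}$ be a sequence of non-negative (real-valued) random variables on it; no boundedness in $L^1$ is assumed. Then there exist a measurable function $f:\Omega\to[0,+\infty]$ and a subsequence $(g_n)_{n\ge1}$ of $(f_n)_{n\ge1}$ such that, for every subsequence $(h_n)_{n\ge1}$ of $(g_n)_{n\ge1}$ and every permutation (bijection) $\pi$ of $\{1,2,\dots\}$, $$\lim_{n\to\infty}\frac1n\sum_{k=1}^{n}h_{\pi(k)}=f\quad\mu\text{-a.e.},$$ where the convergence is in $[0,+\infty]$, and the exceptional null set may depend on $(h_n)$ and $\pi$. -/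

import Mathlib

open MeasureTheory Filter Topology
open scoped ENNReal

/-- The `n`-th Cesàro mean `(1/n) (x 0 + ... + x (n-1))` of a real sequence
(a sequence indexed by `1, 2, ...` is re-indexed by `0, 1, ...`). -/
noncomputable def cesaroMean (x : ℕ → ℝ) (n : ℕ) : ℝ :=
  (1 / (n : ℝ)) * ∑ k ∈ Finset.range n, x k

/-! Without an L¹ bound, every estimate is made on truncations. Along a free ultrafilter `min (f n)
k` has a weak L² limit `Z k`; these limits increase with `k`, and the limit function is F = sup_k `Z
k`. The weight s = 1/(1+F) vanishes exactly on {F = ∞} and satisfies `Z k` · s² ≤ 1, so weighted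
first moments of truncations stay bounded in the limit. The elementary bound `sum_sq_min_div_le`
turns this into a summable sequence of normalized truncated second moments.

A diagonal choice (`exists_almost_uncorrelated_subsequence`) gives a subsequence with these second
moment bounds and tiny truncated covariances, for the weights 1 and s. Both controls survive any
injective reindexing, hence subsequences and permutations. They suffice for Etemadi's form of the
strong law (`ae_tendsto_average_of_weighted_covariance`): second moments along ⌊α^j⌋, then
monotonicity of the partial sums fills the gaps.

Where F < ∞, the weight s is positive, the k-th term is truncated at a level growing with k, and a
Borel–Cantelli argument removes the truncation. Where F = ∞, the averages dominate those truncated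
at a fixed level K, which tend to `Z K`, and K is arbitrary. -/

/-! ### Strong law for almost uncorrelated nonnegative variables. -/

theorem integrable_of_measurable_of_abs_le {Ω : Type*} [MeasurableSpace Ω] {μ : Measure Ω}
    [IsFiniteMeasure μ] {g : Ω → ℝ} (hg : Measurable g) (hb : ∃ C, ∀ ω, |g ω| ≤ C) :
    Integrable g μ := by
  obtain ⟨C, hC⟩ := hb
  exact Integrable.of_bound hg.aestronglyMeasurable C (ae_of_all _ hC)

theorem exists_abs_mul_le {Ω : Type*} {g h : Ω → ℝ} (hg : ∃ C, ∀ ω, |g ω| ≤ C)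
    (hh : ∃ C, ∀ ω, |h ω| ≤ C) : ∃ C, ∀ ω, |g ω * h ω| ≤ C := by
  obtain ⟨C, hC⟩ := hg
  obtain ⟨C', hC'⟩ := hh
  refine ⟨C * C', fun ω => ?_⟩
  rw [abs_mul]
  exact mul_le_mul (hC ω) (hC' ω) (abs_nonneg _) ((abs_nonneg _).trans (hC ω))

theorem exists_abs_sub_le {Ω : Type*} {g h : Ω → ℝ} (hg : ∃ C, ∀ ω, |g ω| ≤ C)
    (hh : ∃ C, ∀ ω, |h ω| ≤ C) : ∃ C, ∀ ω, |g ω - h ω| ≤ C := by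
  obtain ⟨C, hC⟩ := hg
  obtain ⟨C', hC'⟩ := hh
  exact ⟨C + C', fun ω => (abs_sub _ _).trans (add_le_add (hC ω) (hC' ω))⟩

theorem ae_summable_of_summable_integral {Ω : Type*} [MeasurableSpace Ω] {μ : Measure Ω}
    {g : ℕ → Ω → ℝ} (hint : ∀ j, Integrable (g j) μ) (h0 : ∀ j ω, 0 ≤ g j ω)
    (hs : Summable fun j => ∫ ω, g j ω ∂μ) : ∀ᵐ ω ∂μ, Summable fun j => g j ω := by
  have hmeas : ∀ j, AEMeasurable (fun ω => ENNReal.ofReal (g j ω)) μ :=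
    fun j => (hint j).aemeasurable.ennreal_ofReal
  have hfin : ∫⁻ ω, ∑' j, ENNReal.ofReal (g j ω) ∂μ ≠ ∞ := by
    rw [lintegral_tsum hmeas]
    simp_rw [← fun j => ofReal_integral_eq_lintegral_ofReal (hint j) (ae_of_all _ (h0 j))]
    exact hs.tsum_ofReal_ne_top
  filter_upwards [ae_lt_top' (AEMeasurable.tsum hmeas) hfin] with ω hω
  simpa [ENNReal.toReal_ofReal (h0 _ ω)] using ENNReal.summable_toReal hω.ne

/-- Summing the second moments of the averages along `⌊α ^ j⌋₊`. -/
theorem summable_weighted_sum_floor_pow {a v : ℕ → ℝ} (hv0 : ∀ k, 0 ≤ v k) (hv : Summable v)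
    {B : ℝ} (hB : 0 ≤ B) {α : ℝ} (hα : 1 < α) (ha0 : ∀ N, 0 ≤ a N)
    (ha : ∀ N, a N ≤ (∑ k ∈ Finset.range N, ((k : ℝ) + 1) ^ 2 * v k) + B) :
    Summable fun j : ℕ => a ⌊α ^ j⌋₊ / (⌊α ^ j⌋₊ : ℝ) ^ 2 := by
  set C := α ^ 5 * (α - 1)⁻¹ ^ 3 with hC
  have hC0 : 0 ≤ C := by
    have : 0 < α - 1 := by linarith
    positivity
  have key : ∀ (J k : ℕ), ∑ j ∈ Finset.range J,
      (if k < ⌊α ^ j⌋₊ then 1 / (⌊α ^ j⌋₊ : ℝ) ^ 2 else 0) ≤ 4 * C / ((k : ℝ) + 1) ^ 2 := by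
    intro J k
    -- The library bound sums over a strict inequality with a real threshold; halving `k + 1` makes
    -- `k + 1 ≤ ⌊α ^ j⌋₊` strict and costs the factor 4.
    have hk : (0 : ℝ) < ((k : ℝ) + 1) / 2 := by positivity
    have h := sum_div_nat_floor_pow_sq_le_div_sq J hk hα
    rw [Finset.sum_filter] at h
    refine (Finset.sum_le_sum fun j _ => ?_).trans (h.trans (le_of_eq ?_))
    · split_ifs with h1 h2 h2
      · exact le_rfl
      · exact absurd (lt_of_lt_of_le (by linarith [show (0 : ℝ) ≤ k from k.cast_nonneg])
          (show ((k : ℝ) + 1) ≤ (⌊α ^ j⌋₊ : ℝ) by exact_mod_cast h1)) h2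
      · positivity
      · exact le_rfl
    · rw [← hC]
      field_simp
      norm_num
  refine summable_of_sum_range_le (c := 4 * C * ∑' k, v k + B * (4 * C))
    (fun j => div_nonneg (ha0 _) (by positivity)) fun J => ?_
  -- Any common upper bound for the first `J` floors would do: it gives all inner sums the same
  -- finite range, so that they can be exchanged.
  set M := ∑ j ∈ Finset.range J, ⌊α ^ j⌋₊ with hM
  have hstep : ∀ j ∈ Finset.range J, a ⌊α ^ j⌋₊ / (⌊α ^ j⌋₊ : ℝ) ^ 2 ≤
      (∑ k ∈ Finset.range M, ((k : ℝ) + 1) ^ 2 * v k *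
        (if k < ⌊α ^ j⌋₊ then 1 / (⌊α ^ j⌋₊ : ℝ) ^ 2 else 0)) +
      B * (if 0 < ⌊α ^ j⌋₊ then 1 / (⌊α ^ j⌋₊ : ℝ) ^ 2 else 0) := by
    intro j hj
    have hpos : 0 < ⌊α ^ j⌋₊ := Nat.floor_pos.2 (one_le_pow₀ hα.le)
    have hle : ⌊α ^ j⌋₊ ≤ M :=
      Finset.single_le_sum (f := fun j => ⌊α ^ j⌋₊) (fun _ _ => Nat.zero_le _) hj
    have hsum : (∑ k ∈ Finset.range M, ((k : ℝ) + 1) ^ 2 * v k *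
        (if k < ⌊α ^ j⌋₊ then 1 / (⌊α ^ j⌋₊ : ℝ) ^ 2 else 0)) =
        (∑ k ∈ Finset.range ⌊α ^ j⌋₊, ((k : ℝ) + 1) ^ 2 * v k) * (1 / (⌊α ^ j⌋₊ : ℝ) ^ 2) := by
      rw [Finset.sum_mul]
      symm
      refine Finset.sum_subset_zero_on_sdiff (Finset.range_mono hle) ?_ ?_
      · intro k hk
        simp only [Finset.mem_sdiff, Finset.mem_range] at hk
        simp [hk.2]
      · intro k hk
        rw [if_pos (Finset.mem_range.1 hk)]
    rw [hsum, if_pos hpos, ← add_mul, div_eq_mul_one_div]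
    exact mul_le_mul_of_nonneg_right (ha _) (by positivity)
  refine (Finset.sum_le_sum hstep).trans ?_
  rw [Finset.sum_add_distrib, Finset.sum_comm, ← Finset.mul_sum]
  refine add_le_add ?_ (mul_le_mul_of_nonneg_left (by simpa using key J 0) hB)
  calc _ ≤ ∑ k ∈ Finset.range M, 4 * C * v k := by
        refine Finset.sum_le_sum fun k _ => ?_
        rw [← Finset.mul_sum]
        refine (mul_le_mul_of_nonneg_left (key J k) (by have := hv0 k; positivity)).trans
          (le_of_eq ?_)
        field_simp
    _ ≤ _ := by
        rw [← Finset.mul_sum]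
        exact mul_le_mul_of_nonneg_left (hv.sum_le_tsum _ fun k _ => hv0 k) (by positivity)

/-- Expanding the square, the off-diagonal terms contribute at most (∑ u)², so the second moments of
the averages along ⌊α^j⌋ are summable. Only upper bounds on covariances are needed. -/
theorem ae_tendsto_average_floor_pow {Ω : Type*} [MeasurableSpace Ω] {μ : Measure Ω}
    [IsFiniteMeasure μ] {E : ℕ → Ω → ℝ} (hm : ∀ k, Measurable (E k))
    (hb : ∀ k, ∃ C, ∀ ω, |E k ω| ≤ C) {u v : ℕ → ℝ} (hu0 : ∀ k, 0 ≤ u k) (hu : Summable u)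
    (hv0 : ∀ k, 0 ≤ v k) (hv : Summable v)
    (hoff : ∀ k l, k ≠ l → ∫ ω, E k ω * E l ω ∂μ ≤ u k * u l)
    (hdiag : ∀ k, ∫ ω, E k ω * E k ω ∂μ ≤ ((k : ℝ) + 1) ^ 2 * v k) {α : ℝ} (hα : 1 < α) :
    ∀ᵐ ω ∂μ, Tendsto (fun j : ℕ => (∑ k ∈ Finset.range ⌊α ^ j⌋₊, E k ω) / (⌊α ^ j⌋₊ : ℝ))
      atTop (𝓝 0) := by
  have hint : ∀ k l, Integrable (fun ω => E k ω * E l ω) μ := fun k l =>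
    integrable_of_measurable_of_abs_le ((hm k).mul (hm l)) (exists_abs_mul_le (hb k) (hb l))
  have hexp : ∀ N (ω : Ω), (∑ k ∈ Finset.range N, E k ω) ^ 2 =
      ∑ k ∈ Finset.range N, ∑ l ∈ Finset.range N, E k ω * E l ω := fun N ω => by
    rw [sq, Finset.sum_mul_sum]
  have hsqint : ∀ N, Integrable (fun ω => (∑ k ∈ Finset.range N, E k ω) ^ 2) μ := fun N => by
    simp_rw [hexp]
    exact integrable_finsetSum _ fun k _ => integrable_finsetSum _ fun l _ => hint k l
  have hI : ∀ N, ∫ ω, (∑ k ∈ Finset.range N, E k ω) ^ 2 ∂μ ≤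
      (∑ k ∈ Finset.range N, ((k : ℝ) + 1) ^ 2 * v k) + (∑' k, u k) ^ 2 := by
    intro N
    simp_rw [hexp]
    rw [integral_finsetSum _ fun k _ => integrable_finsetSum _ fun l _ => hint k l]
    calc _ ≤ ∑ k ∈ Finset.range N, ∑ l ∈ Finset.range N,
          ((if k = l then ((k : ℝ) + 1) ^ 2 * v k else 0) + u k * u l) := by
          refine Finset.sum_le_sum fun k _ => ?_
          rw [integral_finsetSum _ fun l _ => hint k l]
          refine Finset.sum_le_sum fun l _ => ?_
          split_ifs with h
          · subst h
            exact (hdiag k).trans (le_add_of_nonneg_right (mul_nonneg (hu0 k) (hu0 k)))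
          · rw [zero_add]
            exact hoff k l h
      _ = (∑ k ∈ Finset.range N, ((k : ℝ) + 1) ^ 2 * v k) + (∑ k ∈ Finset.range N, u k) ^ 2 := by
          simp_rw [Finset.sum_add_distrib, Finset.sum_ite_eq, sq (∑ k ∈ Finset.range N, u k),
            Finset.sum_mul_sum]
          congr 1
          exact Finset.sum_congr rfl fun k hk => if_pos hk
      _ ≤ _ := by
          gcongr
          · exact Finset.sum_nonneg fun k _ => hu0 k
          · exact hu.sum_le_tsum _ fun k _ => hu0 k
  have hsum := summable_weighted_sum_floor_pow hv0 hv (sq_nonneg (∑' k, u k)) hα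
    (fun N => integral_nonneg fun ω => sq_nonneg (∑ k ∈ Finset.range N, E k ω)) hI
  have hae := ae_summable_of_summable_integral (μ := μ)
    (g := fun j ω => (∑ k ∈ Finset.range ⌊α ^ j⌋₊, E k ω) ^ 2 / (⌊α ^ j⌋₊ : ℝ) ^ 2)
    (fun j => (hsqint _).div_const _) (fun j ω => by positivity)
    (by simpa only [integral_div] using hsum)
  filter_upwards [hae] with ω hω
  have h := hω.tendsto_atTop_zero
  simp_rw [← div_pow] at h
  have h2 := h.sqrt
  simp_rw [Real.sqrt_sq_eq_abs, Real.sqrt_zero] at h2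
  exact (tendsto_zero_iff_abs_tendsto_zero _).2 h2

/-- A strong law for nonnegative, almost uncorrelated random variables `Y k` with centerings
`z k`, on the set where the weight `s` does not vanish. It does not depend on the order of the
variables beyond the growth of the second moments. -/
theorem ae_tendsto_average_of_weighted_covariance {Ω : Type*} [MeasurableSpace Ω] {μ : Measure Ω}
    [IsFiniteMeasure μ] {Y z : ℕ → Ω → ℝ} {s : Ω → ℝ} (hY0 : ∀ k ω, 0 ≤ Y k ω)
    (hm : ∀ k, Measurable fun ω => (Y k ω - z k ω) * s ω)
    (hb : ∀ k, ∃ C, ∀ ω, |(Y k ω - z k ω) * s ω| ≤ C) {u v : ℕ → ℝ}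
    (hu0 : ∀ k, 0 ≤ u k) (hu : Summable u) (hv0 : ∀ k, 0 ≤ v k) (hv : Summable v)
    (hoff : ∀ k l, k ≠ l →
      ∫ ω, ((Y k ω - z k ω) * s ω) * ((Y l ω - z l ω) * s ω) ∂μ ≤ u k * u l)
    (hdiag : ∀ k, ∫ ω, ((Y k ω - z k ω) * s ω) * ((Y k ω - z k ω) * s ω) ∂μ ≤
      ((k : ℝ) + 1) ^ 2 * v k) :
    ∀ᵐ ω ∂μ, s ω ≠ 0 → ∀ l, Tendsto (fun k => z k ω) atTop (𝓝 l) →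
      Tendsto (fun n : ℕ => (∑ k ∈ Finset.range n, Y k ω) / (n : ℝ)) atTop (𝓝 l) := by
  set c : ℕ → ℝ := fun i => 1 + 1 / ((i : ℝ) + 1) with hc
  have hc1 : ∀ i, 1 < c i := fun i => lt_add_of_pos_right _ (by positivity)
  have hclim : Tendsto c atTop (𝓝 1) := by
    simpa [hc] using (tendsto_const_nhds (x := (1 : ℝ))).add
      (tendsto_one_div_add_atTop_nhds_zero_nat (𝕜 := ℝ))
  have hall : ∀ᵐ ω ∂μ, ∀ i, Tendsto (fun j : ℕ =>
      (∑ k ∈ Finset.range ⌊c i ^ j⌋₊, (Y k ω - z k ω) * s ω) / (⌊c i ^ j⌋₊ : ℝ)) atTop (𝓝 0) :=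
    ae_all_iff.2 fun i => ae_tendsto_average_floor_pow hm hb hu0 hu hv0 hv hoff hdiag (hc1 i)
  filter_upwards [hall] with ω hω hs l hl
  -- Nonnegativity of `Y` makes the partial sums monotone, so convergence along geometric
  -- subsequences with ratios tending to 1 is enough.
  refine tendsto_div_of_monotone_of_tendsto_div_floor_pow
    (fun n => ∑ k ∈ Finset.range n, Y k ω) l ?_ c hc1 hclim fun i => ?_
  · exact fun a b hab => Finset.sum_le_sum_of_subset_of_nonneg (Finset.range_mono hab)
      fun k _ _ => hY0 k ω
  · have hfl : Tendsto (fun j : ℕ => ⌊c i ^ j⌋₊) atTop atTop :=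
      tendsto_nat_floor_atTop.comp (tendsto_pow_atTop_atTop_of_one_lt (hc1 i))
    have h1 := (hω i).div_const (s ω)
    have h2 := hl.cesaro.comp hfl
    have h3 := h1.add h2
    rw [zero_div, zero_add] at h3
    refine h3.congr fun j => ?_
    simp only [Function.comp, ← Finset.sum_mul, Finset.sum_sub_distrib]
    field_simp
    ring

/-! ### Weak limits along an ultrafilter. -/

/-- Banach–Alaoglu in the dual, carried back by the Riesz isometry. -/
theorem exists_tendsto_inner_of_norm_le {ι H : Type*} [NormedAddCommGroup H]
    [InnerProductSpace ℝ H] [CompleteSpace H] (U : Ultrafilter ι) (x : ι → H) {C : ℝ}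
    (hx : ∀ i, ‖x i‖ ≤ C) :
    ∃ z : H, ∀ y, Tendsto (fun i => inner ℝ (x i) y) U (𝓝 (inner ℝ z y)) := by
  set T : ι → WeakDual ℝ H :=
    fun i => StrongDual.toWeakDual (InnerProductSpace.toDual ℝ H (x i)) with hT
  have hmem : ↑(U.map T) ≤ 𝓟 (WeakDual.toStrongDual ⁻¹'
      Metric.closedBall (0 : StrongDual ℝ H) C) := by
    rw [le_principal_iff]
    refine Filter.univ_mem' (f := (U : Filter ι)) fun i => ?_
    have : ‖InnerProductSpace.toDual ℝ H (x i)‖ ≤ C := by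
      rw [LinearIsometryEquiv.norm_map]
      exact hx i
    simpa [hT] using this
  obtain ⟨p, -, hp⟩ := (WeakDual.isCompact_closedBall (0 : StrongDual ℝ H) C).ultrafilter_le_nhds
    (U.map T) hmem
  refine ⟨(InnerProductSpace.toDual ℝ H).symm (WeakDual.toStrongDual p), fun y => ?_⟩
  have h1 : Tendsto T U (𝓝 p) := hp
  have h2 := ((WeakDual.eval_continuous y).tendsto p).comp h1
  rw [InnerProductSpace.toDual_symm_apply]
  exact h2.congr fun i => by simp [hT]

theorem exists_weak_limit_of_bounded {ι Ω : Type*} [MeasurableSpace Ω] {μ : Measure Ω}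
    [IsProbabilityMeasure μ] (U : Ultrafilter ι) {h : ι → Ω → ℝ} (hm : ∀ i, Measurable (h i))
    {C : ℝ} (hb : ∀ i ω, |h i ω| ≤ C) :
    ∃ z : Ω → ℝ, Measurable z ∧ Integrable z μ ∧ ∀ g : Ω → ℝ, Measurable g →
      (∃ B, ∀ ω, |g ω| ≤ B) →
      Tendsto (fun i => ∫ ω, h i ω * g ω ∂μ) U (𝓝 (∫ ω, z ω * g ω ∂μ)) := by
  have hL : ∀ i, MemLp (h i) 2 μ := fun i =>
    MemLp.of_bound (hm i).aestronglyMeasurable C (ae_of_all _ (hb i))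
  have hn : ∀ i, ‖(hL i).toLp (h i)‖ ≤ C := fun i => by
    have hC : 0 ≤ C := by
      obtain ⟨ω⟩ := (inferInstance : NeZero μ).out |> fun h => nonempty_of_measure_ne_zero
        (μ := μ) (s := Set.univ) (by simp)
      exact (abs_nonneg _).trans (hb i ω)
    rw [Lp.norm_toLp]
    refine ENNReal.toReal_le_of_le_ofReal hC
      ((eLpNorm_le_of_ae_bound (ae_of_all _ (hb i))).trans ?_)
    simp
  obtain ⟨z, hz⟩ := exists_tendsto_inner_of_norm_le U _ hn
  have hzm := (Lp.aestronglyMeasurable z).aemeasurable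
  have hzi : Integrable z μ := (Lp.memLp z).integrable (by norm_num)
  refine ⟨hzm.mk z, hzm.measurable_mk, hzi.congr hzm.ae_eq_mk, fun g hg ⟨B, hB⟩ => ?_⟩
  have hgL : MemLp g 2 μ := MemLp.of_bound hg.aestronglyMeasurable B (ae_of_all _ hB)
  have h1 := hz (hgL.toLp g)
  simp only [L2.inner_def] at h1
  have e1 : ∀ i, ∫ ω, inner ℝ ((hL i).toLp (h i) ω) (hgL.toLp g ω) ∂μ = ∫ ω, h i ω * g ω ∂μ :=
    fun i => integral_congr_ae (by
      filter_upwards [(hL i).coeFn_toLp, hgL.coeFn_toLp] with ω a b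
      simp [a, b, mul_comm])
  have e2 : ∫ ω, inner ℝ (z ω) (hgL.toLp g ω) ∂μ = ∫ ω, hzm.mk z ω * g ω ∂μ :=
    integral_congr_ae (by
      filter_upwards [hzm.ae_eq_mk, hgL.coeFn_toLp] with ω a b
      simp [← a, b, mul_comm])
  rw [e2] at h1
  exact h1.congr e1

theorem ae_le_of_weak_limits {ι Ω : Type*} [MeasurableSpace Ω] {μ : Measure Ω}
    [IsProbabilityMeasure μ] {U : Ultrafilter ι} {h h' : ι → Ω → ℝ} {z z' : Ω → ℝ}
    (hz : Integrable z μ) (hz' : Integrable z' μ) (hi : ∀ i, Integrable (h i) μ)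
    (hi' : ∀ i, Integrable (h' i) μ) (hle : ∀ i ω, h i ω ≤ h' i ω)
    (hlim : ∀ g : Ω → ℝ, Measurable g → (∃ B, ∀ ω, |g ω| ≤ B) →
      Tendsto (fun i => ∫ ω, h i ω * g ω ∂μ) U (𝓝 (∫ ω, z ω * g ω ∂μ)))
    (hlim' : ∀ g : Ω → ℝ, Measurable g → (∃ B, ∀ ω, |g ω| ≤ B) →
      Tendsto (fun i => ∫ ω, h' i ω * g ω ∂μ) U (𝓝 (∫ ω, z' ω * g ω ∂μ))) :
    z ≤ᵐ[μ] z' := by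
  refine ae_le_of_forall_setIntegral_le hz hz' fun A hA _ => ?_
  have hind : ∀ p : Ω → ℝ, ∫ ω, p ω * A.indicator (fun _ => (1 : ℝ)) ω ∂μ = ∫ ω in A, p ω ∂μ := by
    intro p
    rw [← integral_indicator hA]
    congr 1 with ω
    by_cases hω : ω ∈ A <;> simp [hω]
  have hg : Measurable (A.indicator fun _ => (1 : ℝ)) := measurable_const.indicator hA
  have hgb : ∃ B, ∀ ω, |A.indicator (fun _ => (1 : ℝ)) ω| ≤ B :=
    ⟨1, fun ω => by by_cases hω : ω ∈ A <;> simp [hω]⟩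
  have l1 := hlim _ hg hgb
  have l2 := hlim' _ hg hgb
  simp only [hind] at l1 l2
  exact le_of_tendsto_of_tendsto' l1 l2 fun i =>
    setIntegral_mono (hi i).integrableOn (hi' i).integrableOn (hle i)

/-- Along an ultrafilter, the truncations `min (f n) k` of nonnegative random variables have weak
limits `Z k` that form a pointwise monotone sequence. -/
theorem exists_truncation_weak_limits {Ω : Type*} [MeasurableSpace Ω] {μ : Measure Ω}
    [IsProbabilityMeasure μ] (U : Ultrafilter ℕ) {f : ℕ → Ω → ℝ} (hf : ∀ n, Measurable (f n))
    (hf0 : ∀ n ω, 0 ≤ f n ω) :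
    ∃ Z : ℕ → Ω → ℝ, (∀ k, Measurable (Z k)) ∧ (∀ k ω, 0 ≤ Z k ω) ∧ (∀ (k : ℕ) ω, Z k ω ≤ k) ∧
      (∀ ω, Monotone fun k => Z k ω) ∧ ∀ (k : ℕ) (g : Ω → ℝ), Measurable g → (∃ B, ∀ ω, |g ω| ≤ B) →
        Tendsto (fun n => ∫ ω, min (f n ω) k * g ω ∂μ) U (𝓝 (∫ ω, Z k ω * g ω ∂μ)) := by
  have hb : ∀ (k n : ℕ) (ω), |min (f n ω) (k : ℝ)| ≤ k := fun k n ω => by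
    rw [abs_of_nonneg (le_min (hf0 n ω) k.cast_nonneg)]
    exact min_le_right _ _
  have hm : ∀ k n : ℕ, Measurable fun ω => min (f n ω) (k : ℝ) :=
    fun k n => (hf n).min measurable_const
  have hi : ∀ k n : ℕ, Integrable (fun ω => min (f n ω) (k : ℝ)) μ :=
    fun k n => integrable_of_measurable_of_abs_le (hm k n) ⟨k, hb k n⟩
  choose z hzm hzi hz using fun k : ℕ => exists_weak_limit_of_bounded (μ := μ) U (hm k) (hb k)
  have h0 : ∀ k, ∀ᵐ ω ∂μ, 0 ≤ z k ω := fun k =>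
    ae_le_of_weak_limits (U := U) (h := fun _ _ => 0) (h' := fun n ω => min (f n ω) (k : ℝ))
      (z := fun _ => 0) (integrable_zero _ _ _) (hzi k) (fun _ => integrable_zero _ _ _) (hi k)
      (fun n ω => le_min (hf0 n ω) k.cast_nonneg) (fun g _ _ => tendsto_const_nhds) (hz k)
  have h1 : ∀ k : ℕ, ∀ᵐ ω ∂μ, z k ω ≤ k := fun k =>
    ae_le_of_weak_limits (U := U) (h' := fun _ _ => (k : ℝ)) (h := fun n ω => min (f n ω) (k : ℝ))
      (z' := fun _ => (k : ℝ)) (hzi k) (integrable_const _) (hi k) (fun _ => integrable_const _)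
      (fun n ω => min_le_right _ _) (hz k) (fun g _ _ => tendsto_const_nhds)
  have h2 : ∀ k : ℕ, ∀ᵐ ω ∂μ, z k ω ≤ z (k + 1) ω := fun k =>
    ae_le_of_weak_limits (U := U) (hzi k) (hzi (k + 1)) (hi k) (hi (k + 1))
      (fun n ω => min_le_min_left _ (by push_cast; linarith)) (hz k) (hz (k + 1))
  have hall : ∀ᵐ ω ∂μ, ∀ k : ℕ, 0 ≤ z k ω ∧ z k ω ≤ k ∧ z k ω ≤ z (k + 1) ω := by
    rw [ae_all_iff]
    intro k
    filter_upwards [h0 k, h1 k, h2 k] with ω a b c using ⟨a, b, c⟩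
  -- The inequalities hold only almost everywhere; setting every `z k` to 0 on a measurable null set
  -- makes them hold everywhere without changing any integral.
  set N := toMeasurable μ {ω | ¬ ∀ k : ℕ, 0 ≤ z k ω ∧ z k ω ≤ k ∧ z k ω ≤ z (k + 1) ω} with hN
  have hNm : MeasurableSet N := measurableSet_toMeasurable _ _
  have hgood : ∀ ω ∈ Nᶜ, ∀ k : ℕ, 0 ≤ z k ω ∧ z k ω ≤ k ∧ z k ω ≤ z (k + 1) ω := by
    intro ω hω
    by_contra h
    exact hω (subset_toMeasurable _ _ h)
  have hNae : ∀ᵐ ω ∂μ, ω ∈ Nᶜ := by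
    have h : μ N = 0 := (measure_toMeasurable _).trans hall
    exact compl_mem_ae_iff.2 h
  refine ⟨fun k => Nᶜ.indicator (z k), fun k => (hzm k).indicator hNm.compl, fun k ω => ?_,
    fun k ω => ?_, fun ω => monotone_nat_of_le_succ fun k => ?_, fun k g hg hgb => ?_⟩
  · exact Set.indicator_nonneg (fun ω hω => (hgood ω hω k).1) ω
  · exact Set.indicator_le' (fun ω hω => (hgood ω hω k).2.1) (fun _ _ => k.cast_nonneg) ω
  · by_cases hω : ω ∈ Nᶜ
    · simpa only [Set.indicator_of_mem hω] using (hgood ω hω k).2.2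
    · simp only [Set.indicator_of_notMem hω, le_refl]
  · have : ∫ ω, Nᶜ.indicator (z k) ω * g ω ∂μ = ∫ ω, z k ω * g ω ∂μ :=
      integral_congr_ae (by
        filter_upwards [hNae] with ω hω
        simp only [Set.indicator_of_mem hω])
    rw [this]
    exact hz k g hg hgb

/-! ### Choice of the subsequence. -/

/-- Diagonal selection along a filter. -/
theorem exists_strictMono_of_eventually {U : Filter ℕ} [U.NeBot] (hU : U ≤ atTop)
    {A : ℕ → ℕ → Prop} {B : ℕ → ℕ → ℕ → Prop} (hA : ∀ j, ∀ᶠ n in U, A j n)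
    (hB : ∀ j p, ∀ᶠ n in U, B j p n) :
    ∃ φ : ℕ → ℕ, StrictMono φ ∧ (∀ j, A j (φ j)) ∧ ∀ i j, i < j → B j (φ i) (φ j) := by
  -- Asking for `B j p n` at all `p ≤ N`, with `N` the previously chosen index, is a finite
  -- condition that covers every earlier choice.
  have hstep : ∀ j N, ∃ n, N < n ∧ A j n ∧ ∀ p ∈ Set.Iic N, B j p n := fun j N =>
    (((eventually_gt_atTop N).filter_mono hU).and ((hA j).and
      ((eventually_all_finite (Set.finite_Iic N)).2 fun p _ => hB j p))).exists
  choose F hF1 hF2 hF3 using hstep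
  let φ : ℕ → ℕ := fun j => Nat.rec (F 0 0) (fun i N => F (i + 1) N) j
  have hφ : StrictMono φ := strictMono_nat_of_lt_succ fun i => hF1 (i + 1) (φ i)
  refine ⟨φ, hφ, fun j => ?_, fun i j hij => ?_⟩
  · cases j with
    | zero => exact hF2 0 0
    | succ i => exact hF2 (i + 1) (φ i)
  · cases j with
    | zero => exact absurd hij (Nat.not_lt_zero _)
    | succ j => exact hF3 (j + 1) (φ j) (φ i) (hφ.monotone (Nat.lt_succ_iff.1 hij))

theorem abs_min_natCast_le {x : ℝ} (hx : 0 ≤ x) (k : ℕ) : |min x (k : ℝ)| ≤ k := by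
  rw [abs_of_nonneg (le_min hx k.cast_nonneg)]
  exact min_le_right _ _

/-- About `x` of the terms equal 1, and the remaining tail ∑ x²/k² over k ≥ x is again of order `x`.
-/
theorem sum_sq_min_div_le {x : ℝ} (hx : 0 ≤ x) (K : ℕ) :
    ∑ k ∈ Finset.range K, (min x ((k + 1 : ℕ) : ℝ) / ((k + 1 : ℕ) : ℝ)) ^ 2 ≤
      2 * min x (K : ℝ) + 1 := by
  have hone : ∀ K : ℕ, ∑ k ∈ Finset.range K,
      (min x ((k + 1 : ℕ) : ℝ) / ((k + 1 : ℕ) : ℝ)) ^ 2 ≤ K := by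
    intro K
    refine (Finset.sum_le_card_nsmul _ _ 1 fun k _ => ?_).trans (by simp)
    have h0 : 0 ≤ min x ((k + 1 : ℕ) : ℝ) / ((k + 1 : ℕ) : ℝ) := by positivity
    exact pow_le_one₀ h0 (div_le_one_of_le₀ (min_le_right _ _) (by positivity))
  -- The extra `- x ^ 2 / K` makes the induction telescope, through 1/(K+1)² ≤ 1/K − 1/(K+1). It
  -- starts at the first positive integer not below `x`, where counting terms suffices.
  have hlarge : ∀ K : ℕ, x ≤ K → 0 < K → ∑ k ∈ Finset.range K,
      (min x ((k + 1 : ℕ) : ℝ) / ((k + 1 : ℕ) : ℝ)) ^ 2 ≤ 2 * x + 1 - x ^ 2 / K := by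
    intro K
    induction K with
    | zero => intro _ h; exact absurd h (lt_irrefl _)
    | succ K ih =>
      intro hxK _
      have hK1 : (0 : ℝ) < ((K + 1 : ℕ) : ℝ) := by positivity
      by_cases h : x ≤ K ∧ 0 < K
      · have hK : (0 : ℝ) < K := by exact_mod_cast h.2
        rw [Finset.sum_range_succ, min_eq_left hxK]
        have h1 := ih h.1 h.2
        have h2 : (x / ((K + 1 : ℕ) : ℝ)) ^ 2 ≤ x ^ 2 / K - x ^ 2 / ((K + 1 : ℕ) : ℝ) := by
          have h3 : x ^ 2 / K - x ^ 2 / ((K + 1 : ℕ) : ℝ) = x ^ 2 / (K * ((K + 1 : ℕ) : ℝ)) := by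
            field_simp
            push_cast
            ring
          rw [h3, div_pow]
          gcongr
          rw [sq]
          gcongr
          linarith
        linarith
      · have hKx : (K : ℝ) ≤ x := by
          rcases not_and_or.1 h with h | h
          · exact (not_le.1 h).le
          · have : K = 0 := by omega
            simpa [this] using hx
        have h1 := hone (K + 1)
        have h2 : x ^ 2 / ((K + 1 : ℕ) : ℝ) ≤ x := by
          rw [div_le_iff₀ hK1, sq]
          gcongr
        push_cast at *
        linarith
  rcases le_total x K with h | h
  · rcases Nat.eq_zero_or_pos K with rfl | hK
    · rw [min_eq_left h]
      simp only [Finset.range_zero, Finset.sum_empty]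
      linarith
    · rw [min_eq_left h]
      refine (hlarge K h hK).trans ?_
      have : 0 ≤ x ^ 2 / K := by positivity
      linarith
  · rw [min_eq_right h]
    refine (hone K).trans ?_
    have : (0 : ℝ) ≤ K := K.cast_nonneg
    linarith

section Truncation

variable {Ω : Type*} [MeasurableSpace Ω] {μ : Measure Ω} [IsProbabilityMeasure μ]
  {U : Ultrafilter ℕ} {f : ℕ → Ω → ℝ} {Z : ℕ → Ω → ℝ} {s : Ω → ℝ}

/-- Each limit exists by compactness of [0,1]. Integrating `sum_sq_min_div_le` against s² and
passing to the limit bounds the partial sums by 2∫ `Z K` s² + ∫ s² ≤ 3. -/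
theorem exists_second_moment_limits (hf : ∀ n, Measurable (f n)) (hf0 : ∀ n ω, 0 ≤ f n ω)
    (hlim : ∀ (k : ℕ) (g : Ω → ℝ), Measurable g → (∃ B, ∀ ω, |g ω| ≤ B) →
      Tendsto (fun n => ∫ ω, min (f n ω) k * g ω ∂μ) U (𝓝 (∫ ω, Z k ω * g ω ∂μ)))
    (hs : Measurable s) (hs0 : ∀ ω, 0 ≤ s ω) (hs1 : ∀ ω, s ω ≤ 1)
    (hZs : ∀ k ω, Z k ω * s ω ^ 2 ≤ 1) :
    ∃ q : ℕ → ℝ, (∀ k, 0 ≤ q k) ∧ Summable q ∧ ∀ k, Tendsto (fun n =>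
      ∫ ω, (min (f n ω) ((k + 1 : ℕ) : ℝ) / ((k + 1 : ℕ) : ℝ)) ^ 2 * s ω ^ 2 ∂μ) U (𝓝 (q k)) := by
  have hr0 : ∀ (k n : ℕ) ω, 0 ≤ min (f n ω) ((k + 1 : ℕ) : ℝ) / ((k + 1 : ℕ) : ℝ) :=
    fun k n ω => div_nonneg (le_min (hf0 n ω) (by positivity)) (by positivity)
  have hr1 : ∀ (k n : ℕ) ω, min (f n ω) ((k + 1 : ℕ) : ℝ) / ((k + 1 : ℕ) : ℝ) ≤ 1 :=
    fun k n ω => div_le_one_of_le₀ (min_le_right _ _) (by positivity)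
  have hX0 : ∀ (k n : ℕ) ω,
      0 ≤ (min (f n ω) ((k + 1 : ℕ) : ℝ) / ((k + 1 : ℕ) : ℝ)) ^ 2 * s ω ^ 2 :=
    fun k n ω => by positivity
  have hX1 : ∀ (k n : ℕ) ω,
      (min (f n ω) ((k + 1 : ℕ) : ℝ) / ((k + 1 : ℕ) : ℝ)) ^ 2 * s ω ^ 2 ≤ 1 :=
    fun k n ω => mul_le_one₀ (pow_le_one₀ (hr0 k n ω) (hr1 k n ω)) (by positivity)
      (pow_le_one₀ (hs0 ω) (hs1 ω))
  have hXi : ∀ k n : ℕ, Integrable (fun ω =>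
      (min (f n ω) ((k + 1 : ℕ) : ℝ) / ((k + 1 : ℕ) : ℝ)) ^ 2 * s ω ^ 2) μ := fun k n =>
    integrable_of_measurable_of_abs_le
      (((((hf n).min measurable_const).div_const _).pow_const 2).mul (hs.pow_const 2))
      ⟨1, fun ω => by rw [abs_of_nonneg (hX0 k n ω)]; exact hX1 k n ω⟩
  have hex : ∀ k : ℕ, ∃ q ∈ Set.Icc (0 : ℝ) 1, Tendsto (fun n =>
      ∫ ω, (min (f n ω) ((k + 1 : ℕ) : ℝ) / ((k + 1 : ℕ) : ℝ)) ^ 2 * s ω ^ 2 ∂μ) U (𝓝 q) := by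
    intro k
    refine (isCompact_Icc (a := (0 : ℝ)) (b := 1)).ultrafilter_le_nhds (U.map _) ?_
    rw [le_principal_iff]
    refine Filter.univ_mem' (f := (U : Filter ℕ)) fun n => ⟨integral_nonneg (hX0 k n), ?_⟩
    refine (integral_mono (hXi k n) (integrable_const 1) (hX1 k n)).trans ?_
    simp
  choose q hq hqlim using hex
  refine ⟨q, fun k => (hq k).1, summable_of_sum_range_le (c := 3) (fun k => (hq k).1) fun K => ?_,
    hqlim⟩
  have hs2 : Measurable fun ω => s ω ^ 2 := hs.pow_const 2
  have hs2b : ∀ ω, |s ω ^ 2| ≤ 1 := fun ω => by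
    rw [abs_of_nonneg (by positivity)]
    exact pow_le_one₀ (hs0 ω) (hs1 ω)
  have hs2i : Integrable (fun ω => s ω ^ 2) μ :=
    integrable_of_measurable_of_abs_le hs2 ⟨1, hs2b⟩
  have hTi : ∀ n, Integrable (fun ω => min (f n ω) (K : ℝ) * s ω ^ 2) μ := fun n =>
    integrable_of_measurable_of_abs_le (((hf n).min measurable_const).mul hs2)
      (exists_abs_mul_le ⟨K, fun ω => abs_min_natCast_le (hf0 n ω) K⟩ ⟨1, hs2b⟩)
  have hl := ((hlim K _ hs2 ⟨1, hs2b⟩).const_mul 2).add_const (∫ ω, s ω ^ 2 ∂μ)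
  refine (le_of_tendsto_of_tendsto' (tendsto_finsetSum (Finset.range K) fun k _ => hqlim k) hl
    fun n => ?_).trans ?_
  · rw [← integral_finsetSum _ fun k _ => hXi k n, ← integral_const_mul,
      ← integral_add ((hTi n).const_mul 2) hs2i]
    refine integral_mono (integrable_finsetSum _ fun k _ => hXi k n)
      (((hTi n).const_mul 2).add hs2i) fun ω => ?_
    have := mul_le_mul_of_nonneg_right (sum_sq_min_div_le (hf0 n ω) K) (sq_nonneg (s ω))
    rw [Finset.sum_mul] at this
    exact this.trans (le_of_eq (by ring))
  · have h1 : ∫ ω, Z K ω * s ω ^ 2 ∂μ ≤ 1 := by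
      by_cases hi : Integrable (fun ω => Z K ω * s ω ^ 2) μ
      · simpa using integral_mono hi (integrable_const 1) (hZs K)
      · rw [integral_undef hi]
        exact zero_le_one
    have h2 : ∫ ω, s ω ^ 2 ∂μ ≤ 1 := by
      simpa using integral_mono hs2i (integrable_const 1) fun ω => (le_abs_self _).trans (hs2b ω)
    linarith

/-- With `p` frozen, the first factor times t² is a bounded test function, so this is weak
convergence. -/
theorem tendsto_integral_truncation_cov (hf : ∀ n, Measurable (f n)) (hf0 : ∀ n ω, 0 ≤ f n ω)
    (hZm : ∀ k, Measurable (Z k)) (hZb : ∀ (k : ℕ) ω, |Z k ω| ≤ k)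
    (hlim : ∀ (k : ℕ) (g : Ω → ℝ), Measurable g → (∃ B, ∀ ω, |g ω| ≤ B) →
      Tendsto (fun n => ∫ ω, min (f n ω) k * g ω ∂μ) U (𝓝 (∫ ω, Z k ω * g ω ∂μ)))
    {t : Ω → ℝ} (ht : Measurable t) (htb : ∃ B, ∀ ω, |t ω| ≤ B) (p a b : ℕ) :
    Tendsto (fun n => ∫ ω, ((min (f p ω) a - Z a ω) * t ω) * ((min (f n ω) b - Z b ω) * t ω) ∂μ)
      U (𝓝 0) := by
  set g : Ω → ℝ := fun ω => ((min (f p ω) a - Z a ω) * t ω) * t ω with hg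
  have hgm : Measurable g := ((((hf p).min measurable_const).sub (hZm a)).mul ht).mul ht
  have hgb : ∃ B, ∀ ω, |g ω| ≤ B := exists_abs_mul_le (exists_abs_mul_le (exists_abs_sub_le
    ⟨a, fun ω => abs_min_natCast_le (hf0 p ω) a⟩ ⟨a, hZb a⟩) htb) htb
  have h := (hlim b g hgm hgb).sub_const (∫ ω, Z b ω * g ω ∂μ)
  rw [sub_self] at h
  refine h.congr fun n => ?_
  rw [← integral_sub]
  · congr 1 with ω
    simp only [hg]
    ring
  · exact integrable_of_measurable_of_abs_le (((hf n).min measurable_const).mul hgm)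
      (exists_abs_mul_le ⟨b, fun ω => abs_min_natCast_le (hf0 n ω) b⟩ hgb)
  · exact integrable_of_measurable_of_abs_le ((hZm b).mul hgm)
      (exists_abs_mul_le ⟨b, hZb b⟩ hgb)

/-- Weak lower semicontinuity of the L² norm: expand ∫ (min(fₙ,k) − `Z k`)² s² ≥ 0 and let n run
along `U`. -/
theorem integral_sq_weak_limit_le (hf : ∀ n, Measurable (f n)) (hf0 : ∀ n ω, 0 ≤ f n ω)
    (hZm : ∀ k, Measurable (Z k)) (hZb : ∀ (k : ℕ) ω, |Z k ω| ≤ k)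
    (hlim : ∀ (k : ℕ) (g : Ω → ℝ), Measurable g → (∃ B, ∀ ω, |g ω| ≤ B) →
      Tendsto (fun n => ∫ ω, min (f n ω) k * g ω ∂μ) U (𝓝 (∫ ω, Z k ω * g ω ∂μ)))
    (hs : Measurable s) (hsb : ∃ B, ∀ ω, |s ω| ≤ B) {k : ℕ} (hk : k ≠ 0) {q : ℝ}
    (hq : Tendsto (fun n => ∫ ω, (min (f n ω) (k : ℝ) / (k : ℝ)) ^ 2 * s ω ^ 2 ∂μ) U (𝓝 q)) :
    ∫ ω, (Z k ω * s ω) ^ 2 ∂μ ≤ (k : ℝ) ^ 2 * q := by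
  have hTb : ∀ n, ∃ B, ∀ ω, |min (f n ω) (k : ℝ)| ≤ B :=
    fun n => ⟨k, fun ω => abs_min_natCast_le (hf0 n ω) k⟩
  have hTm : ∀ n, Measurable fun ω => min (f n ω) (k : ℝ) := fun n => (hf n).min measurable_const
  have hgm : Measurable fun ω => Z k ω * s ω ^ 2 := (hZm k).mul (hs.pow_const 2)
  have hs2b : ∃ B, ∀ ω, |s ω ^ 2| ≤ B := by simpa only [sq] using exists_abs_mul_le hsb hsb
  have hgb : ∃ B, ∀ ω, |Z k ω * s ω ^ 2| ≤ B := exists_abs_mul_le ⟨k, hZb k⟩ hs2b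
  have i1 : ∀ n, Integrable (fun ω => (min (f n ω) (k : ℝ) / (k : ℝ)) ^ 2 * s ω ^ 2) μ := by
    intro n
    refine integrable_of_measurable_of_abs_le (((hTm n).div_const _).pow_const 2 |>.mul
      (hs.pow_const 2)) (exists_abs_mul_le ?_ hs2b)
    have h := exists_abs_mul_le (hTb n) (⟨|(k : ℝ)⁻¹|, fun _ => le_rfl⟩ :
      ∃ B, ∀ _ : Ω, |(k : ℝ)⁻¹| ≤ B)
    simpa only [sq, div_eq_mul_inv] using exists_abs_mul_le h h
  have i2 : ∀ n, Integrable (fun ω => min (f n ω) (k : ℝ) * (Z k ω * s ω ^ 2)) μ := fun n =>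
    integrable_of_measurable_of_abs_le ((hTm n).mul hgm) (exists_abs_mul_le (hTb n) hgb)
  have i3 : Integrable (fun ω => Z k ω * (Z k ω * s ω ^ 2)) μ :=
    integrable_of_measurable_of_abs_le ((hZm k).mul hgm) (exists_abs_mul_le ⟨k, hZb k⟩ hgb)
  have hk' : (k : ℝ) ≠ 0 := Nat.cast_ne_zero.2 hk
  have hpos : ∀ n, 0 ≤ (k : ℝ) ^ 2 * (∫ ω, (min (f n ω) (k : ℝ) / (k : ℝ)) ^ 2 * s ω ^ 2 ∂μ) -
      2 * (∫ ω, min (f n ω) (k : ℝ) * (Z k ω * s ω ^ 2) ∂μ) +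
      ∫ ω, Z k ω * (Z k ω * s ω ^ 2) ∂μ := by
    intro n
    rw [← integral_const_mul, ← integral_const_mul,
      ← integral_sub ((i1 n).const_mul _) ((i2 n).const_mul _),
      ← integral_add (show Integrable (fun ω =>
          (k : ℝ) ^ 2 * ((min (f n ω) (k : ℝ) / (k : ℝ)) ^ 2 * s ω ^ 2) -
            2 * (min (f n ω) (k : ℝ) * (Z k ω * s ω ^ 2))) μ from
          ((i1 n).const_mul _).sub ((i2 n).const_mul _)) i3]
    refine integral_nonneg fun ω => ?_
    have : (k : ℝ) ^ 2 * ((min (f n ω) (k : ℝ) / (k : ℝ)) ^ 2 * s ω ^ 2) -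
        2 * (min (f n ω) (k : ℝ) * (Z k ω * s ω ^ 2)) + Z k ω * (Z k ω * s ω ^ 2) =
        ((min (f n ω) (k : ℝ) - Z k ω) * s ω) ^ 2 := by
      field_simp
      ring
    rw [Pi.zero_apply, this]
    positivity
  have hl := (((hq.const_mul ((k : ℝ) ^ 2)).sub ((hlim k _ hgm hgb).const_mul 2)).add_const
    (∫ ω, Z k ω * (Z k ω * s ω ^ 2) ∂μ))
  have := ge_of_tendsto' hl hpos
  have e : ∫ ω, (Z k ω * s ω) ^ 2 ∂μ = ∫ ω, Z k ω * (Z k ω * s ω ^ 2) ∂μ := by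
    congr 1 with ω
    ring
  rw [e]
  linarith

/-- Selection of a subsequence whose truncations are almost uncorrelated, for the weights `1`
and `s`, and whose truncated second moments are controlled by a summable sequence. -/
theorem exists_almost_uncorrelated_subsequence (hU : (U : Filter ℕ) ≤ atTop)
    (hf : ∀ n, Measurable (f n)) (hf0 : ∀ n ω, 0 ≤ f n ω)
    (hZm : ∀ k, Measurable (Z k)) (hZb : ∀ (k : ℕ) ω, |Z k ω| ≤ k)
    (hlim : ∀ (k : ℕ) (g : Ω → ℝ), Measurable g → (∃ B, ∀ ω, |g ω| ≤ B) →
      Tendsto (fun n => ∫ ω, min (f n ω) k * g ω ∂μ) U (𝓝 (∫ ω, Z k ω * g ω ∂μ)))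
    (hs : Measurable s) (hs0 : ∀ ω, 0 ≤ s ω) (hs1 : ∀ ω, s ω ≤ 1)
    (hZs : ∀ k ω, Z k ω * s ω ^ 2 ≤ 1) :
    ∃ (q : ℕ → ℝ) (φ : ℕ → ℕ), (∀ k, 0 ≤ q k) ∧ Summable q ∧ StrictMono φ ∧
      (∀ k : ℕ, ∫ ω, (Z (k + 1) ω * s ω) ^ 2 ∂μ ≤ ((k : ℝ) + 1) ^ 2 * q k) ∧
      (∀ j k c : ℕ, c = min (k + 1) (2 ^ j) →
        ∫ ω, (min (f (φ j) ω) c / c) ^ 2 * s ω ^ 2 ∂μ ≤ q k + 2 * (1 / 2) ^ j) ∧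
      ∀ t ∈ ({fun _ => 1, s} : Set (Ω → ℝ)), ∀ i j, i < j → ∀ a : ℕ, a ≤ 2 ^ j → ∀ b : ℕ, b ≤ 2 ^ j →
        ∫ ω, ((min (f (φ i) ω) a - Z a ω) * t ω) *
          ((min (f (φ j) ω) b - Z b ω) * t ω) ∂μ ≤ (1 / 4) ^ j := by
  obtain ⟨q, hq0, hqs, hq⟩ := exists_second_moment_limits hf hf0 hlim hs hs0 hs1 hZs
  have hsb : ∀ ω, |s ω| ≤ 1 := fun ω => by
    rw [abs_of_nonneg (hs0 ω)]
    exact hs1 ω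
  have hs2b : ∀ ω, |s ω ^ 2| ≤ 1 := fun ω => by
    rw [abs_of_nonneg (by positivity)]
    exact pow_le_one₀ (hs0 ω) (hs1 ω)
  have hs2m : Measurable fun ω => s ω ^ 2 := hs.pow_const 2
  obtain ⟨φ, hφ, hA, hB⟩ := exists_strictMono_of_eventually (U := (U : Filter ℕ)) hU
    -- Only finitely many conditions may be imposed at stage `j`, so levels stop near `2 ^ j`. The
    -- first moment bound (limit at most 1, hence eventually at most 2) handles larger `k`.
    (A := fun j n => (∀ k ∈ Set.Iic (2 ^ j),
      ∫ ω, (min (f n ω) ((k + 1 : ℕ) : ℝ) / ((k + 1 : ℕ) : ℝ)) ^ 2 * s ω ^ 2 ∂μ ≤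
        q k + (1 / 2) ^ j) ∧ ∫ ω, min (f n ω) ((2 ^ j : ℕ) : ℝ) * s ω ^ 2 ∂μ ≤ 2)
    (B := fun j p n => ∀ t ∈ ({fun _ => 1, s} : Set (Ω → ℝ)), ∀ a : ℕ, a ∈ Set.Iic (2 ^ j) →
      ∀ b : ℕ, b ∈ Set.Iic (2 ^ j) → ∫ ω, ((min (f p ω) a - Z a ω) * t ω) *
          ((min (f n ω) b - Z b ω) * t ω) ∂μ ≤ (1 / 4) ^ j)
    (fun j => by
      refine ((eventually_all_finite (Set.finite_Iic _)).2 fun k _ => ?_).and ?_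
      · exact ((hq k).eventually_lt_const (lt_add_of_pos_right _ (by positivity))).mono
          fun n h => h.le
      · have h : ∫ ω, Z (2 ^ j) ω * s ω ^ 2 ∂μ < 2 := by
          have hi : Integrable (fun ω => Z (2 ^ j) ω * s ω ^ 2) μ :=
            integrable_of_measurable_of_abs_le ((hZm _).mul hs2m)
              (exists_abs_mul_le ⟨_, hZb _⟩ ⟨1, hs2b⟩)
          have := integral_mono hi (integrable_const 1) (hZs _)
          simp only [integral_const, probReal_univ, smul_eq_mul, mul_one] at this
          linarith
        exact ((hlim _ _ hs2m ⟨1, hs2b⟩).eventually_lt_const h).mono fun n h => h.le)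
    (fun j p => by
      refine (eventually_all_finite (Set.toFinite _)).2 fun t ht =>
        (eventually_all_finite (Set.finite_Iic _)).2 fun a _ =>
        (eventually_all_finite (Set.finite_Iic _)).2 fun b _ => ?_
      have htm : Measurable t ∧ ∃ B, ∀ ω, |t ω| ≤ B := by
        rcases ht with rfl | rfl
        · exact ⟨measurable_const, 1, fun _ => by simp⟩
        · exact ⟨hs, 1, hsb⟩
      exact ((tendsto_integral_truncation_cov hf hf0 hZm hZb hlim htm.1 htm.2
        p a b).eventually_lt_const (by positivity)).mono fun n h => h.le)
  refine ⟨q, φ, hq0, hqs, hφ, fun k => ?_, fun j k c hc => ?_,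
    fun t ht i j hij a ha b hb => hB i j hij t ht a ha b hb⟩
  · have := integral_sq_weak_limit_le hf hf0 hZm hZb hlim hs ⟨1, hsb⟩ k.succ_ne_zero (hq k)
    simpa using this
  · rcases le_total (k + 1) (2 ^ j) with h | h
    · rw [min_eq_left h] at hc
      subst hc
      refine ((hA j).1 k (Set.mem_Iic.2 (by omega))).trans ?_
      have : (0 : ℝ) ≤ (1 / 2) ^ j := by positivity
      linarith
    -- Here the level is `c = 2 ^ j`. Since the ratio min(f,c)/c lies in [0,1], its square is at
    -- most itself, and the first moment bound gives 2/c = 2 · 2^(−j).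
    · rw [min_eq_right h] at hc
      have hc0 : (0 : ℝ) < c := by rw [hc]; positivity
      have h2 := (hA j).2
      rw [← hc] at h2
      have hb := hq0 k
      have hi : Integrable (fun ω => min (f (φ j) ω) c * s ω ^ 2) μ :=
        integrable_of_measurable_of_abs_le (((hf _).min measurable_const).mul hs2m)
          (exists_abs_mul_le ⟨c, fun ω => abs_min_natCast_le (hf0 _ ω) c⟩ ⟨1, hs2b⟩)
      have h3 : ∫ ω, (min (f (φ j) ω) c / c) ^ 2 * s ω ^ 2 ∂μ ≤
          ∫ ω, (1 / (c : ℝ)) * (min (f (φ j) ω) c * s ω ^ 2) ∂μ := by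
        refine integral_mono_of_nonneg (ae_of_all _ fun ω => by positivity) (hi.const_mul _)
          (ae_of_all _ fun ω => ?_)
        have h0 : 0 ≤ min (f (φ j) ω) (c : ℝ) / c :=
          div_nonneg (le_min (hf0 _ ω) hc0.le) hc0.le
        have h1 : min (f (φ j) ω) (c : ℝ) / c ≤ 1 :=
          div_le_one_of_le₀ (min_le_right _ _) hc0.le
        calc _ ≤ (min (f (φ j) ω) (c : ℝ) / c) * s ω ^ 2 := by
              refine mul_le_mul_of_nonneg_right ?_ (sq_nonneg _)
              rw [sq]
              exact mul_le_of_le_one_left h0 h1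
          _ = _ := by ring
      rw [integral_const_mul] at h3
      have h4 : (1 / (c : ℝ)) * ∫ ω, min (f (φ j) ω) c * s ω ^ 2 ∂μ ≤ (1 / (c : ℝ)) * 2 :=
        mul_le_mul_of_nonneg_left h2 (by positivity)
      have h5 : (1 / (c : ℝ)) = (1 / 2) ^ j := by
        rw [hc]
        push_cast
        rw [one_div_pow]
      rw [h5] at h3 h4
      linarith

end Truncation

/-! ### Averages along an arbitrary injective reindexing. -/

/-- A permutation may reverse the order of two indices, but the integral is symmetric and
4^(−max(i,j)) ≤ 2^(−i) 2^(−j), a product form that is summable along any injection. -/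
theorem integral_mul_le_of_injective {Ω : Type*} [MeasurableSpace Ω] {μ : Measure Ω}
    {X : ℕ → ℕ → Ω → ℝ}
    (hX : ∀ i j, i < j → ∀ a : ℕ, a ≤ 2 ^ j → ∀ b : ℕ, b ≤ 2 ^ j →
      ∫ ω, X i a ω * X j b ω ∂μ ≤ (1 / 4) ^ j)
    {m : ℕ → ℕ} (hm : Function.Injective m) {c : ℕ → ℕ} (hc : ∀ k, c k ≤ 2 ^ m k) {k l : ℕ}
    (hkl : k ≠ l) :
    ∫ ω, X (m k) (c k) ω * X (m l) (c l) ω ∂μ ≤ (1 / 2) ^ m k * (1 / 2) ^ m l := by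
  have key : ∀ k l, m k < m l →
      ∫ ω, X (m k) (c k) ω * X (m l) (c l) ω ∂μ ≤ (1 / 2) ^ m k * (1 / 2) ^ m l := by
    intro k l h
    refine (hX _ _ h _ ((hc k).trans (Nat.pow_le_pow_right two_pos h.le)) _ (hc l)).trans ?_
    rw [show (1 / 4 : ℝ) = (1 / 2) * (1 / 2) by norm_num, mul_pow]
    exact mul_le_mul_of_nonneg_right
      (pow_le_pow_of_le_one (by norm_num) (by norm_num) h.le) (by positivity)
  rcases lt_or_gt_of_ne (hm.ne hkl) with h | h
  · exact key k l h
  · rw [mul_comm ((1 / 2 : ℝ) ^ m k)]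
    simpa only [mul_comm] using key l k h

theorem summable_half_pow_of_injective {m : ℕ → ℕ} (hm : Function.Injective m) :
    Summable fun k => (1 / 2 : ℝ) ^ m k :=
  summable_geometric_two.comp_injective hm

theorem eventually_le_two_pow_of_injective {m : ℕ → ℕ} (hm : Function.Injective m) (K : ℕ) :
    ∀ᶠ k in atTop, K ≤ 2 ^ m k :=
  (hm.nat_tendsto_atTop.eventually_ge_atTop K).mono fun _ h => h.trans Nat.lt_two_pow_self.le

section Averages

variable {Ω : Type*} [MeasurableSpace Ω] {μ : Measure Ω} [IsProbabilityMeasure μ]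
  {f : ℕ → Ω → ℝ} {Z : ℕ → Ω → ℝ} {s : Ω → ℝ} {m : ℕ → ℕ}

/-- The law at a fixed level, with weight 1, which also sees {F = ∞}. Capping at `2 ^ m k` keeps
within the controlled levels and, by injectivity, changes only finitely many terms. -/
theorem ae_tendsto_average_min (hf : ∀ n, Measurable (f n)) (hf0 : ∀ n ω, 0 ≤ f n ω)
    (hZm : ∀ k, Measurable (Z k)) (hZ0 : ∀ k ω, 0 ≤ Z k ω) (hZk : ∀ (k : ℕ) ω, Z k ω ≤ k)
    (hcov : ∀ i j, i < j → ∀ a : ℕ, a ≤ 2 ^ j → ∀ b : ℕ, b ≤ 2 ^ j →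
      ∫ ω, ((min (f i ω) a - Z a ω) * 1) * ((min (f j ω) b - Z b ω) * 1) ∂μ ≤ (1 / 4) ^ j)
    (hm : Function.Injective m) (K : ℕ) :
    ∀ᵐ ω ∂μ, Tendsto (fun n : ℕ => (∑ k ∈ Finset.range n,
      min (f (m k) ω) ((min K (2 ^ m k) : ℕ) : ℝ)) / (n : ℝ)) atTop (𝓝 (Z K ω)) := by
  set c : ℕ → ℕ := fun k => min K (2 ^ m k) with hc
  have hDb : ∀ k ω, |(min (f (m k) ω) (c k : ℝ) - Z (c k) ω) * 1| ≤ K := by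
    intro k ω
    have hcK : (c k : ℝ) ≤ K := by exact_mod_cast min_le_left _ _
    have h1 : 0 ≤ min (f (m k) ω) (c k : ℝ) := le_min (hf0 _ _) (Nat.cast_nonneg _)
    have h2 : min (f (m k) ω) (c k : ℝ) ≤ c k := min_le_right _ _
    have h3 := hZ0 (c k) ω
    have h4 := hZk (c k) ω
    rw [mul_one, abs_le]
    constructor <;> linarith
  have hDm : ∀ k, Measurable fun ω => (min (f (m k) ω) (c k : ℝ) - Z (c k) ω) * 1 :=
    fun k => (((hf _).min measurable_const).sub (hZm _)).mul_const 1
  have hv : Summable fun k : ℕ => (K : ℝ) ^ 2 * (1 / ((k + 1 : ℕ) : ℝ) ^ 2) :=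
    ((summable_nat_add_iff 1).2 (Real.summable_one_div_nat_pow.2 one_lt_two)).mul_left _
  have h := ae_tendsto_average_of_weighted_covariance (μ := μ)
    (Y := fun k ω => min (f (m k) ω) (c k : ℝ)) (z := fun k => Z (c k)) (s := fun _ => 1)
    (u := fun k => (1 / 2) ^ m k)
    (fun k ω => le_min (hf0 _ _) (Nat.cast_nonneg _)) hDm (fun k => ⟨K, hDb k⟩)
    (fun k => by positivity) (summable_half_pow_of_injective hm) (fun k => by positivity) hv
    (fun k l hkl => integral_mul_le_of_injective
      (X := fun i a ω => (min (f i ω) (a : ℝ) - Z a ω) * 1) hcov hm (c := c)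
      (fun k => min_le_right _ _) hkl)
    (fun k => by
      have hi : Integrable (fun ω => (min (f (m k) ω) (c k : ℝ) - Z (c k) ω) * 1 *
          ((min (f (m k) ω) (c k : ℝ) - Z (c k) ω) * 1)) μ :=
        integrable_of_measurable_of_abs_le ((hDm k).mul (hDm k))
          (exists_abs_mul_le ⟨K, hDb k⟩ ⟨K, hDb k⟩)
      have h1 := integral_mono hi (integrable_const ((K : ℝ) ^ 2)) fun ω => by
        rw [← sq, ← sq_abs]
        exact pow_le_pow_left₀ (abs_nonneg _) (hDb k ω) 2
      simp only [integral_const, probReal_univ, smul_eq_mul, one_mul] at h1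
      refine h1.trans (le_of_eq ?_)
      push_cast
      field_simp)
  filter_upwards [h] with ω hω
  refine hω one_ne_zero _ (tendsto_const_nhds.congr' ?_)
  filter_upwards [eventually_le_two_pow_of_injective hm K] with k hk
  simp only [hc, min_eq_left hk]

theorem ae_tendsto_average_of_second_moments (hf : ∀ n, Measurable (f n))
    (hf0 : ∀ n ω, 0 ≤ f n ω)
    (hZm : ∀ k, Measurable (Z k)) (hZ0 : ∀ k ω, 0 ≤ Z k ω) (hZk : ∀ (k : ℕ) ω, Z k ω ≤ k)
    (hZmono : ∀ ω, Monotone fun k => Z k ω)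
    (hs : Measurable s) (hs0 : ∀ ω, 0 ≤ s ω) (hs1 : ∀ ω, s ω ≤ 1)
    {q : ℕ → ℝ} (hq0 : ∀ k, 0 ≤ q k) (hq : Summable q)
    (hZq : ∀ k : ℕ, ∫ ω, (Z (k + 1) ω * s ω) ^ 2 ∂μ ≤ ((k : ℝ) + 1) ^ 2 * q k)
    (hfq : ∀ j k c : ℕ, c = min (k + 1) (2 ^ j) →
      ∫ ω, (min (f j ω) c / c) ^ 2 * s ω ^ 2 ∂μ ≤ q k + 2 * (1 / 2) ^ j)
    (hcov : ∀ i j, i < j → ∀ a : ℕ, a ≤ 2 ^ j → ∀ b : ℕ, b ≤ 2 ^ j →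
      ∫ ω, ((min (f i ω) a - Z a ω) * s ω) * ((min (f j ω) b - Z b ω) * s ω) ∂μ ≤ (1 / 4) ^ j)
    (hm : Function.Injective m) :
    ∀ᵐ ω ∂μ, s ω ≠ 0 → ∀ l, Tendsto (fun k => Z k ω) atTop (𝓝 l) →
      Tendsto (fun n : ℕ => (∑ k ∈ Finset.range n, f (m k) ω) / (n : ℝ)) atTop (𝓝 l) := by
  -- `k + 1` is the level natural to position `k` in the average; `2 ^ m k` is the largest level
  -- controlled by the selection at index `m k`. A permutation leaves the two unrelated.
  set c : ℕ → ℕ := fun k => min (k + 1) (2 ^ m k) with hc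
  have hc0 : ∀ k, (0 : ℝ) < c k := fun k => by
    have : 0 < c k := lt_min k.succ_pos (by positivity)
    exact_mod_cast this
  have hck : ∀ k, (c k : ℝ) ≤ (k : ℝ) + 1 := fun k => by
    exact_mod_cast min_le_left (k + 1) (2 ^ m k)
  have hsb : ∃ B, ∀ ω, |s ω| ≤ B := ⟨1, fun ω => by rw [abs_of_nonneg (hs0 ω)]; exact hs1 ω⟩
  have hZb : ∀ k : ℕ, ∃ B, ∀ ω, |Z k ω| ≤ B :=
    fun k => ⟨k, fun ω => by rw [abs_of_nonneg (hZ0 k ω)]; exact hZk k ω⟩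
  have hTb : ∀ k, ∃ B, ∀ ω, |min (f (m k) ω) (c k : ℝ)| ≤ B :=
    fun k => ⟨c k, fun ω => abs_min_natCast_le (hf0 _ ω) _⟩
  have hTm : ∀ k, Measurable fun ω => min (f (m k) ω) (c k : ℝ) :=
    fun k => (hf _).min measurable_const
  have hT0 : ∀ k ω, 0 ≤ min (f (m k) ω) (c k : ℝ) := fun k ω => le_min (hf0 _ _) (hc0 k).le
  have hDm : ∀ k, Measurable fun ω => (min (f (m k) ω) (c k : ℝ) - Z (c k) ω) * s ω :=
    fun k => ((hTm k).sub (hZm _)).mul hs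
  have hDb : ∀ k, ∃ B, ∀ ω, |(min (f (m k) ω) (c k : ℝ) - Z (c k) ω) * s ω| ≤ B :=
    fun k => exists_abs_mul_le (exists_abs_sub_le (hTb k) (hZb _)) hsb
  have hRi : ∀ k, Integrable (fun ω => (min (f (m k) ω) (c k : ℝ) / c k) ^ 2 * s ω ^ 2) μ := by
    intro k
    have h := exists_abs_mul_le (hTb k) (⟨|(c k : ℝ)⁻¹|, fun _ => le_rfl⟩ :
      ∃ B, ∀ _ : Ω, |(c k : ℝ)⁻¹| ≤ B)
    refine integrable_of_measurable_of_abs_le ((((hTm k).div_const _).pow_const 2).mul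
      (hs.pow_const 2)) ?_
    simpa only [sq, div_eq_mul_inv] using
      exists_abs_mul_le (exists_abs_mul_le h h) (exists_abs_mul_le hsb hsb)
  have hZi : ∀ k, Integrable (fun ω => (Z k ω * s ω) ^ 2) μ := fun k => by
    refine integrable_of_measurable_of_abs_le (((hZm k).mul hs).pow_const 2) ?_
    have h := exists_abs_mul_le (hZb k) hsb
    simpa only [sq] using exists_abs_mul_le h h
  have hhalf := (summable_half_pow_of_injective hm).mul_left 2
  have hlaw := ae_tendsto_average_of_weighted_covariance (μ := μ)
    (Y := fun k ω => min (f (m k) ω) (c k : ℝ)) (z := fun k => Z (c k)) (s := s)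
    (u := fun k => (1 / 2) ^ m k) (v := fun k => (q k + 2 * (1 / 2) ^ m k) + q k)
    hT0 hDm hDb (fun k => by positivity) (summable_half_pow_of_injective hm)
    (fun k => by have := hq0 k; positivity) ((hq.add hhalf).add hq)
    (fun k l hkl => integral_mul_le_of_injective
      (X := fun i a ω => (min (f i ω) (a : ℝ) - Z a ω) * s ω) hcov hm (c := c)
      (fun k => min_le_right _ _) hkl)
    (fun k => by
      have hpt : ∀ ω, (min (f (m k) ω) (c k : ℝ) - Z (c k) ω) * s ω *
          ((min (f (m k) ω) (c k : ℝ) - Z (c k) ω) * s ω) ≤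
          ((k : ℝ) + 1) ^ 2 * ((min (f (m k) ω) (c k : ℝ) / c k) ^ 2 * s ω ^ 2) +
            (Z (k + 1) ω * s ω) ^ 2 := by
        intro ω
        have h1 : Z (c k) ω ≤ Z (k + 1) ω := hZmono ω (min_le_left _ _)
        have h2 := hZ0 (c k) ω
        have h3 := hT0 k ω
        have h4 : min (f (m k) ω) (c k : ℝ) ≤
            ((k : ℝ) + 1) * (min (f (m k) ω) (c k : ℝ) / c k) := by
          rw [mul_div_assoc', le_div_iff₀ (hc0 k), mul_comm]
          exact mul_le_mul_of_nonneg_right (hck k) h3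
        -- Both terms are nonnegative, so the cross term of the square can be dropped.
        have h5 : (min (f (m k) ω) (c k : ℝ) - Z (c k) ω) ^ 2 ≤
            (((k : ℝ) + 1) * (min (f (m k) ω) (c k : ℝ) / c k)) ^ 2 + Z (k + 1) ω ^ 2 := by
          have h6 := pow_le_pow_left₀ h3 h4 2
          have h7 := pow_le_pow_left₀ h2 h1 2
          have h8 := mul_nonneg h3 h2
          linarith [sub_sq (min (f (m k) ω) (c k : ℝ)) (Z (c k) ω)]
        have := mul_le_mul_of_nonneg_right h5 (sq_nonneg (s ω))
        linarith
      have h1 := integral_mono (integrable_of_measurable_of_abs_le ((hDm k).mul (hDm k))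
        (exists_abs_mul_le (hDb k) (hDb k))) (((hRi k).const_mul _).add (hZi (k + 1))) hpt
      rw [integral_add' ((hRi k).const_mul _) (hZi (k + 1)), integral_const_mul] at h1
      have h2 := mul_le_mul_of_nonneg_left (hfq (m k) k (c k) rfl) (sq_nonneg ((k : ℝ) + 1))
      rw [mul_add]
      exact h1.trans (add_le_add h2 (hZq k)))
  have hsum : Summable fun k => ∫ ω, (min (f (m k) ω) (c k : ℝ) / c k) ^ 2 * s ω ^ 2 ∂μ :=
    Summable.of_nonneg_of_le (fun k => integral_nonneg fun ω => by positivity)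
      (fun k => hfq (m k) k (c k) rfl) (hq.add hhalf)
  have hBC := ae_summable_of_summable_integral hRi (fun k ω => by positivity) hsum
  filter_upwards [hlaw, hBC] with ω h1 h2 hsω l hl
  have hct : Tendsto c atTop atTop := by
    refine tendsto_atTop.2 fun K => ?_
    filter_upwards [eventually_ge_atTop K, eventually_le_two_pow_of_injective hm K] with k a b
      using le_min (by omega) b
  have h3 := h1 hsω l (hl.comp hct)
  have hs2 : 0 < s ω ^ 2 := by positivity
  -- Borel–Cantelli: whenever `f (m k) ω` exceeds `c k`, the summand equals s² > 0, which a
  -- convergent series allows only finitely often.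
  have hev : ∀ᶠ k in atTop, 0 = f (m k) ω - min (f (m k) ω) (c k : ℝ) := by
    filter_upwards [h2.tendsto_atTop_zero.eventually_lt_const hs2] with k hk
    rcases le_total (f (m k) ω) (c k : ℝ) with h | h
    · rw [min_eq_left h, sub_self]
    · rw [min_eq_right h, div_self (hc0 k).ne'] at hk
      simp at hk
  have h4 := (tendsto_const_nhds.congr' hev).cesaro.add h3
  rw [zero_add] at h4
  refine h4.congr fun n => ?_
  rw [Finset.sum_sub_distrib, div_eq_inv_mul, div_eq_inv_mul]
  ring

end Averages

/-! ### The limit function and the conclusion. -/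

theorem mainTheorem1 {Ω : Type*} [MeasurableSpace Ω] (μ : Measure Ω) [IsProbabilityMeasure μ]
    (f : ℕ → Ω → ℝ) (hf_meas : ∀ n, Measurable (f n)) (hf_nonneg : ∀ n ω, 0 ≤ f n ω) :
    ∃ F : Ω → ℝ≥0∞, Measurable F ∧
      ∃ φ : ℕ → ℕ, StrictMono φ ∧
        ∀ ψ : ℕ → ℕ, StrictMono ψ → ∀ π : Equiv.Perm ℕ,
          ∀ᵐ ω ∂μ, Tendsto
            (fun n : ℕ => ENNReal.ofReal (cesaroMean (fun k => f (φ (ψ (π k))) ω) n))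
            atTop (𝓝 (F ω)) := by
  obtain ⟨Z, hZm, hZ0, hZk, hZmono, hlim⟩ :=
    exists_truncation_weak_limits (μ := μ) (hyperfilter ℕ) hf_meas hf_nonneg
  have hZb : ∀ (k : ℕ) ω, |Z k ω| ≤ k := fun k ω => by
    rw [abs_of_nonneg (hZ0 k ω)]
    exact hZk k ω
  set F : Ω → ℝ≥0∞ := fun ω => ⨆ k, ENNReal.ofReal (Z k ω) with hF
  have hFm : Measurable F := Measurable.iSup fun k => (hZm k).ennreal_ofReal
  have hZF : ∀ k ω, ENNReal.ofReal (Z k ω) ≤ F ω :=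
    fun k ω => le_iSup (fun k => ENNReal.ofReal (Z k ω)) k
  -- This is 0 where F = ∞, so `Z k * s ^ 2 ≤ 1` holds everywhere, although F need be neither finite
  -- nor integrable.
  set s : Ω → ℝ := fun ω => ((1 + F ω)⁻¹).toReal with hs
  have hsm : Measurable s := (hFm.const_add 1).inv.ennreal_toReal
  have hs0 : ∀ ω, 0 ≤ s ω := fun ω => ENNReal.toReal_nonneg
  have hsF : ∀ ω, F ω ≠ ∞ → s ω = (1 + (F ω).toReal)⁻¹ := fun ω h => by
    simp only [hs]
    rw [ENNReal.toReal_inv, ENNReal.toReal_add ENNReal.one_ne_top h, ENNReal.toReal_one]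
  have hs1 : ∀ ω, s ω ≤ 1 := fun ω => by
    by_cases h : F ω = ∞
    · simp [hs, h]
    · rw [hsF ω h]
      exact inv_le_one_of_one_le₀ (le_add_of_nonneg_right ENNReal.toReal_nonneg)
  have hZs : ∀ k ω, Z k ω * s ω ^ 2 ≤ 1 := fun k ω => by
    by_cases h : F ω = ∞
    · simp [hs, h]
    · have h1 : Z k ω ≤ (F ω).toReal := by
        have := ENNReal.toReal_mono h (hZF k ω)
        rwa [ENNReal.toReal_ofReal (hZ0 k ω)] at this
      have h2 : Z k ω * s ω ≤ 1 := by
        rw [hsF ω h, ← div_eq_mul_inv]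
        exact div_le_one_of_le₀ (by linarith) (by positivity)
      rw [sq, ← mul_assoc]
      exact mul_le_one₀ h2 (hs0 ω) (hs1 ω)
  obtain ⟨q, φ, hq0, hq, hφ, hZq, hfq, hcov⟩ := exists_almost_uncorrelated_subsequence
    Nat.hyperfilter_le_atTop hf_meas hf_nonneg hZm hZb hlim hsm hs0 hs1 hZs
  refine ⟨F, hFm, φ, hφ, fun ψ hψ π => ?_⟩
  have hm : Function.Injective fun k => ψ (π k) := hψ.injective.comp π.injective
  have hlow := ae_all_iff.2 fun K => ae_tendsto_average_min (μ := μ) (f := fun j => f (φ j))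
    (fun j => hf_meas _) (fun j => hf_nonneg _) hZm hZ0 hZk (hcov _ (by simp)) hm K
  have hup := ae_tendsto_average_of_second_moments (μ := μ) (f := fun j => f (φ j))
    (fun j => hf_meas _) (fun j => hf_nonneg _) hZm hZ0 hZk hZmono hsm hs0 hs1 hq0 hq hZq hfq
    (hcov _ (by simp)) hm
  filter_upwards [hlow, hup] with ω h1 h2
  have hmean : ∀ n, cesaroMean (fun k => f (φ (ψ (π k))) ω) n =
      (∑ k ∈ Finset.range n, f (φ (ψ (π k))) ω) / (n : ℝ) := fun n => by
    rw [cesaroMean, one_div, div_eq_inv_mul]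
  simp_rw [hmean]
  by_cases h : F ω = ∞
  · rw [h]
    refine ENNReal.tendsto_nhds_top fun M => ?_
    have hM : (M : ℝ≥0∞) < F ω := by
      rw [h]
      exact ENNReal.natCast_lt_top M
    obtain ⟨K, hK⟩ := lt_iSup_iff.1 hM
    have hev := (ENNReal.tendsto_ofReal (h1 K)).eventually_const_lt hK
    filter_upwards [hev] with n hn
    refine hn.trans_le (ENNReal.ofReal_le_ofReal ?_)
    gcongr
    exact min_le_left _ _
  · have hlimF : Tendsto (fun k => Z k ω) atTop (𝓝 (F ω).toReal) := by
      have h3 : Tendsto (fun k => ENNReal.ofReal (Z k ω)) atTop (𝓝 (F ω)) :=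
        tendsto_atTop_iSup fun a b hab => ENNReal.ofReal_le_ofReal (hZmono ω hab)
      exact ((ENNReal.tendsto_toReal h).comp h3).congr fun k => ENNReal.toReal_ofReal (hZ0 k ω)
    have hsω : s ω ≠ 0 := by
      rw [hsF ω h]
      positivity
    have h4 := ENNReal.tendsto_ofReal (h2 hsω _ hlimF)
    rwa [ENNReal.ofReal_toReal h] at h4
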